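/- For integers $n \ge 3$ and $1 < k < n/2$, let $C_n(1,k)$ be the simple graph on the vertices $v_0,\dots,v_{n-1}$ in which $v_i$ and $v_j$ are adjacent exactly when $i-j \equiv \pm 1$ or $i-j \equiv \pm k \pmod n$. For a finite graph $G$, let $\chi_D(G)$ (the distinguishing chromatic number of $G$) be the least number of colors in a proper vertex coloring of $G$ such that the identity is the only automorphism of $G$ that preserves the color of every vertex. **Theorem.** Let $n, k$ be integers with $3 < k < n/2$ and $k \neq n/2 - 1$, and suppose that $k^2 \equiv 1 \pmod n$ or $k^2 \equiv -1 \pmod n$. Then $$\chi_D(C_n(1,k)) = \begin{cases} 4 & \text{if } (n,k) = (13,5) \text{ or } (n,k) = (15,4),\\ 3 & \text{otherwise.}\end{cases}$$ -/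

import Mathlib

namespace SimpleGraph

variable {V : Type*}

/-- A proper coloring `C` of the vertices of `G` is distinguishing if the identity is the only
automorphism of `G` that preserves the color of every vertex. -/
def Coloring.IsDistinguishing {G : SimpleGraph V} {α : Type*} (C : G.Coloring α) : Prop :=
  ∀ φ : G ≃g G, (∀ v, C (φ v) = C v) → ∀ v, φ v = v

/-- `G` has a distinguishing proper coloring with (at most) `r` colors. -/
def DistinguishinglyColorable (G : SimpleGraph V) (r : ℕ) : Prop :=
  ∃ C : G.Coloring (Fin r), C.IsDistinguishing

/-- The distinguishing chromatic number of `G`: the least number of colors in a distinguishing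
proper coloring of `G` (and `⊤` if finitely many colors never suffice). -/
noncomputable def distinguishingChromaticNumber (G : SimpleGraph V) : ℕ∞ :=
  ⨅ r ∈ {r : ℕ | G.DistinguishinglyColorable r}, (r : ℕ∞)

/-- The circulant graph `C_n(1, k)`, with vertices the residues modulo `n`: two distinct vertices
are adjacent when their difference, in one of the two orders, is `1` or `k` modulo `n`. -/
def circulantOneK (n k : ℕ) : SimpleGraph (ZMod n) :=
  circulantGraph {1, (k : ZMod n)}

end SimpleGraph

namespace SimpleGraph

/-! ### Distinguishing colorings -/

/-! Automorphisms are rigid here: for `k > 3` and `n ≠ 2k + 2` the only common neighbor of `v - 1`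
and `v + 1` is `v`, so an automorphism preserves arithmetic progressions of step 1 and has the form
`v ↦ c + a v` with `a ∈ {±1, ±k}` (`iso_eq_affine`). Since `k² = ±1`, all these maps occur
(`exists_iso_affine`). Two colors never suffice, because a proper 2-coloring is invariant under `v ↦
v + 2`.

Three colors come from three constructions. For `n` even, `k` is odd: color by parity and mark `{0,
2, s}` with the third color. For `n` odd and `k² = 1`, `n = pq` with `p ∣ k - 1` and `q ∣ k + 1`
coprime, and the graph becomes a direct product of two odd cycles, colored by rows with two altered
vertices; this needs a factor at least 7, which fails only for `(15, 4)`. For `n` odd and `k² = -1`,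
Thue's lemma gives `n = a² + b²` and from it a unit `R` such that `R` and `Rk` both lie in the
middle third modulo `n`; pulling back the coloring by three arcs along `v ↦ R v` works unless `n =
13`. The two exceptions are settled by exhaustive search and explicit 4-colorings. -/

theorem DistinguishinglyColorable.mono {V : Type*} {G : SimpleGraph V} {r s : ℕ} (hrs : r ≤ s)
    (h : G.DistinguishinglyColorable r) : G.DistinguishinglyColorable s := by
  obtain ⟨C, hC⟩ := h
  refine ⟨Coloring.mk (fun v => Fin.castLE hrs (C v)) fun hvw he => C.valid hvw ?_, ?_⟩
  · exact Fin.castLE_injective hrs he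
  · exact fun φ hφ => hC φ fun v => Fin.castLE_injective hrs (hφ v)

theorem distinguishingChromaticNumber_eq_succ {V : Type*} {G : SimpleGraph V} {r : ℕ}
    (h : G.DistinguishinglyColorable (r + 1)) (h' : ¬ G.DistinguishinglyColorable r) :
    G.distinguishingChromaticNumber = ((r + 1 : ℕ) : ℕ∞) := by
  refine le_antisymm (iInf₂_le (r + 1) h) (le_iInf₂ fun s hs => ?_)
  by_contra! hlt
  have : s < r + 1 := by exact_mod_cast hlt
  exact h' (hs.mono (by omega))

/-! ### Adjacency and automorphisms of `C_n(1, k)` -/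

/-- The residues `±1, ±k` that separate adjacent vertices of `C_n(1, k)`. -/
def IsStep {n : ℕ} (k a : ZMod n) : Prop := a = 1 ∨ a = -1 ∨ a = k ∨ a = -k

instance {n : ℕ} (k a : ZMod n) : Decidable (IsStep k a) :=
  inferInstanceAs (Decidable (_ ∨ _ ∨ _ ∨ _))

theorem IsStep.neg {n : ℕ} {k a : ZMod n} (h : IsStep k a) : IsStep k (-a) := by
  rcases h with rfl | rfl | rfl | rfl <;> simp [IsStep]

theorem IsStep.mul {n : ℕ} {k a b : ZMod n} (hsq : k ^ 2 = 1 ∨ k ^ 2 = -1)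
    (ha : IsStep k a) (hb : IsStep k b) : IsStep k (a * b) := by
  have hk : k * k = 1 ∨ k * k = -1 := by simpa [sq] using hsq
  rcases ha with rfl | rfl | rfl | rfl <;> rcases hb with rfl | rfl | rfl | rfl <;>
    rcases hk with hk | hk <;> simp [IsStep, hk]

theorem intCast_zmod_ne_zero {n : ℕ} (z : ℤ) (h0 : 0 < z) (h1 : z < 2 * n) (h2 : z ≠ n) :
    (z : ZMod n) ≠ 0 := by
  rw [Ne, ZMod.intCast_zmod_eq_zero_iff_dvd]
  rintro ⟨m, rfl⟩
  have hn : (0 : ℤ) < n := by nlinarith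
  have hm0 : 0 < m := by nlinarith
  have hm2 : m < 2 := by nlinarith
  obtain rfl : m = 1 := by omega
  simp at h2

section Circulant

variable {n k : ℕ}

theorem circulantOneK_adj (hk : 0 < k) (hkn : 2 * k < n) {u v : ZMod n} :
    (circulantOneK n k).Adj u v ↔ IsStep (k : ZMod n) (v - u) := by
  have h1 : (1 : ZMod n) ≠ 0 := by
    simpa using intCast_zmod_ne_zero (n := n) 1 (by omega) (by omega) (by omega)
  have h2 : (k : ZMod n) ≠ 0 := by
    simpa using intCast_zmod_ne_zero (n := n) k (by omega) (by omega) (by omega)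
  simp only [circulantOneK, circulantGraph_adj, Set.mem_insert_iff, Set.mem_singleton_iff, IsStep]
  constructor
  · rintro ⟨-, (h | h) | (h | h)⟩
    · right; left; rw [← h]; ring
    · right; right; right; rw [← h]; ring
    · exact Or.inl h
    · exact Or.inr (Or.inr (Or.inl h))
  · intro h
    refine ⟨?_, ?_⟩
    · rintro rfl
      simp [h1.symm, h2.symm, h1, h2] at h
    · rcases h with h | h | h | h
      · exact Or.inr (Or.inl h)
      · left; left; rw [← neg_sub, h, neg_neg]
      · exact Or.inr (Or.inr h)
      · left; right; rw [← neg_sub, h, neg_neg]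

/-- The vertices `v - 1` and `v + 1` have no common neighbor besides `v`. -/
theorem eq_neg_one_of_isStep_two_add (hk : 3 < k) (hkn : 2 * k < n) (hne : n ≠ 2 * k + 2)
    {b : ZMod n} (hb : IsStep (k : ZMod n) b) (hb' : IsStep (k : ZMod n) (2 + b)) : b = -1 := by
  have e (z : ℤ) (h0 : 0 < z) (h1 : z < 2 * n) (h2 : z ≠ n) (hz : (z : ZMod n) = 0) : False :=
    intCast_zmod_ne_zero z h0 h1 h2 hz
  have e2 := e 2 (by omega) (by omega) (by omega)
  have e4 := e 4 (by omega) (by omega) (by omega)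
  have em1 := e (k - 1) (by omega) (by omega) (by omega)
  have ep1 := e (k + 1) (by omega) (by omega) (by omega)
  have em3 := e (k - 3) (by omega) (by omega) (by omega)
  have ep3 := e (k + 3) (by omega) (by omega) (by omega)
  have em2 := e (2 * k - 2) (by omega) (by omega) (by omega)
  have ep2 := e (2 * k + 2) (by omega) (by omega) (by omega)
  push_cast at *
  -- Every case except `b = -1` forces one of `2, 4, k ± 1, k ± 3, 2k ± 2` to vanish modulo `n`; the
  -- bounds on `k` and `n ≠ 2k + 2` exclude these.
  rcases hb with rfl | rfl | rfl | rfl <;> rcases hb' with h | h | h | h <;>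
    first
    | rfl
    | exact (e2 (by linear_combination h)).elim
    | exact (e4 (by linear_combination h)).elim
    | exact (em1 (by linear_combination h)).elim
    | exact (em1 (by linear_combination -h)).elim
    | exact (ep1 (by linear_combination h)).elim
    | exact (ep1 (by linear_combination -h)).elim
    | exact (em3 (by linear_combination h)).elim
    | exact (em3 (by linear_combination -h)).elim
    | exact (ep3 (by linear_combination h)).elim
    | exact (ep3 (by linear_combination -h)).elim
    | exact (em2 (by linear_combination h)).elim
    | exact (em2 (by linear_combination -h)).elim
    | exact (ep2 (by linear_combination h)).elim

/-- Automorphisms of `C_n(1, k)` map opposite neighbors `v - 1`, `v + 1` of `v` to opposite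
neighbors of the image of `v`. -/
theorem iso_sub_one (hk : 3 < k) (hkn : 2 * k < n) (hne : n ≠ 2 * k + 2)
    (φ : circulantOneK n k ≃g circulantOneK n k) (v : ZMod n) :
    φ (v - 1) = φ v - (φ (v + 1) - φ v) := by
  have adj := @circulantOneK_adj n k (by omega) hkn
  have ha : IsStep (k : ZMod n) (φ (v + 1) - φ v) :=
    adj.1 (φ.map_rel_iff.2 (adj.2 (by simp [IsStep])))
  have hb : IsStep (k : ZMod n) (φ (v - 1) - φ v) :=
    adj.1 (φ.map_rel_iff.2 (adj.2 (by simp [IsStep])))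
  -- `φ w` is the fourth corner of the parallelogram on `φ v`, `φ (v + 1)`, `φ (v - 1)`, so `w` is a
  -- common neighbor of `v + 1` and `v - 1`, hence `w = v`.
  obtain ⟨w, hw⟩ := φ.surjective (φ (v + 1) + φ (v - 1) - φ v)
  have h1 : IsStep (k : ZMod n) (w - (v + 1)) := by
    refine adj.1 (φ.map_rel_iff.1 (adj.2 ?_))
    rw [hw]; convert hb using 1; ring
  have h2 : IsStep (k : ZMod n) (w - (v - 1)) := by
    refine adj.1 (φ.map_rel_iff.1 (adj.2 ?_))
    rw [hw]; convert ha using 1; ring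
  have h3 := eq_neg_one_of_isStep_two_add hk hkn hne h1 (by convert h2 using 1; ring)
  obtain rfl : w = v := by linear_combination h3
  linear_combination -hw

/-- By `iso_sub_one` the images of consecutive residues form an arithmetic progression, determined
by `φ 0` and `φ 1`. -/
theorem iso_eq_affine (hk : 3 < k) (hkn : 2 * k < n) (hne : n ≠ 2 * k + 2)
    (φ : circulantOneK n k ≃g circulantOneK n k) :
    ∃ a c : ZMod n, IsStep (k : ZMod n) a ∧ ∀ v, φ v = c + a * v := by
  have : NeZero n := ⟨by omega⟩
  have adj := @circulantOneK_adj n k (by omega) hkn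
  refine ⟨φ 1 - φ 0, φ 0, ?_, fun v => ?_⟩
  · exact adj.1 (φ.map_rel_iff.2 (adj.2 (by simp [IsStep])))
  · have key (j : ℕ) : φ (j : ZMod n) = φ 0 + (φ 1 - φ 0) * j ∧
        φ ((j + 1 : ℕ) : ZMod n) = φ 0 + (φ 1 - φ 0) * ((j + 1 : ℕ) : ZMod n) := by
      induction j with
      | zero => simp
      | succ j ih =>
        refine ⟨ih.2, ?_⟩
        have h := iso_sub_one hk hkn hne φ ((j + 1 : ℕ) : ZMod n)
        have e1 : ((j + 1 : ℕ) : ZMod n) - 1 = j := by push_cast; ring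
        have e2 : ((j + 1 : ℕ) : ZMod n) + 1 = ((j + 1 + 1 : ℕ) : ZMod n) := by push_cast; ring
        rw [e1, e2, ih.1, ih.2] at h
        push_cast at h ⊢
        linear_combination h
    simpa using (key v.val).1

/-- The automorphism `v ↦ c + a v` of `C_n(1, k)`, for `k ^ 2 = ±1` and `a ∈ {±1, ±k}`. -/
theorem exists_iso_affine (hk : 0 < k) (hkn : 2 * k < n)
    (hsq : (k : ZMod n) ^ 2 = 1 ∨ (k : ZMod n) ^ 2 = -1) {a : ZMod n}
    (ha : IsStep (k : ZMod n) a) (c : ZMod n) :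
    ∃ φ : circulantOneK n k ≃g circulantOneK n k, ∀ v, φ v = c + a * v := by
  obtain ⟨b, hb, hab⟩ : ∃ b, IsStep (k : ZMod n) b ∧ b * a = 1 := by
    have hk' : (k : ZMod n) * k = 1 ∨ (k : ZMod n) * k = -1 := by simpa [sq] using hsq
    have : a * a = 1 ∨ a * a = -1 := by
      rcases ha with rfl | rfl | rfl | rfl <;> simp [hk']
    rcases this with h | h
    · exact ⟨a, ha, h⟩
    · exact ⟨-a, ha.neg, by linear_combination -h⟩
  refine ⟨⟨⟨fun v => c + a * v, fun v => b * (v - c), fun v => ?_, fun v => ?_⟩, ?_⟩, fun v => rfl⟩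
  · linear_combination v * hab
  · linear_combination (v - c) * hab
  · intro u v
    rw [circulantOneK_adj hk hkn, circulantOneK_adj hk hkn]
    simp only [Equiv.coe_fn_mk]
    constructor
    · intro h
      convert IsStep.mul hsq hb h using 1
      linear_combination (u - v) * hab
    · intro h
      convert IsStep.mul hsq ha h using 1
      ring

/-! ### Criteria for distinguishing colorings -/

theorem distinguishinglyColorable_of_forall (hk : 3 < k) (hkn : 2 * k < n) (hne : n ≠ 2 * k + 2)
    {r : ℕ} (f : ZMod n → Fin r) (h1 : ∀ v, f (v + 1) ≠ f v) (hf : ∀ v, f (v + k) ≠ f v)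
    (hdist : ∀ a c : ZMod n, IsStep (k : ZMod n) a → (∀ v, f (c + a * v) = f v) → a = 1 ∧ c = 0) :
    (circulantOneK n k).DistinguishinglyColorable r := by
  refine ⟨Coloring.mk f fun {u v} huv => ?_, fun φ hφ v => ?_⟩
  · rcases (circulantOneK_adj (by omega) hkn).1 huv with h | h | h | h
    · rw [show v = u + 1 by linear_combination h]; exact (h1 u).symm
    · rw [show u = v + 1 by linear_combination -h]; exact h1 v
    · rw [show v = u + k by linear_combination h]; exact (hf u).symm
    · rw [show u = v + k by linear_combination -h]; exact hf v
  · obtain ⟨a, c, ha, hac⟩ := iso_eq_affine hk hkn hne φ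
    obtain ⟨rfl, rfl⟩ := hdist a c ha fun v => by rw [← hac]; exact hφ v
    rw [hac]; ring

theorem Coloring.circulantOneK_add_ne (hk : 0 < k) (hkn : 2 * k < n) {α : Type*}
    (C : (circulantOneK n k).Coloring α) {a : ZMod n} (ha : IsStep (k : ZMod n) a) (v : ZMod n) :
    C (v + a) ≠ C v :=
  (C.valid ((circulantOneK_adj hk hkn).2 (by simpa using ha))).symm

theorem Coloring.IsDistinguishing.eq_zero_of_affine (hk : 0 < k) (hkn : 2 * k < n)
    (hsq : (k : ZMod n) ^ 2 = 1 ∨ (k : ZMod n) ^ 2 = -1) {α : Type*}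
    {C : (circulantOneK n k).Coloring α} (hC : C.IsDistinguishing) {a c : ZMod n}
    (ha : IsStep (k : ZMod n) a) (h : ∀ v, C (c + a * v) = C v) : a = 1 ∧ c = 0 := by
  obtain ⟨φ, hφ⟩ := exists_iso_affine hk hkn hsq ha c
  have := hC φ fun v => by rw [hφ, h]
  simp only [hφ] at this
  have h0 : c = 0 := by simpa using this 0
  exact ⟨by simpa [h0] using this 1, h0⟩

theorem not_distinguishinglyColorable_two (hk : 0 < k) (hkn : 2 * k < n)
    (hsq : (k : ZMod n) ^ 2 = 1 ∨ (k : ZMod n) ^ 2 = -1) :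
    ¬ (circulantOneK n k).DistinguishinglyColorable 2 := by
  rintro ⟨C, hC⟩
  have h1 : IsStep (k : ZMod n) 1 := Or.inl rfl
  have h2 := (hC.eq_zero_of_affine hk hkn hsq h1 (c := 2) fun v => ?_).2
  · exact intCast_zmod_ne_zero (n := n) 2 (by omega) (by omega) (by omega) (by exact_mod_cast h2)
  · have e1 := C.circulantOneK_add_ne hk hkn h1 v
    have e2 := C.circulantOneK_add_ne hk hkn h1 (v + 1)
    rw [show 2 + 1 * v = v + 1 + 1 by ring]
    omega

end Circulant

/-! ### Even `n`: parity with three marked vertices -/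

section Even

variable {n : ℕ}

/-- The coloring of `ZMod n`, `n` even, by parity, with a third color on `{0, 2, s}`. -/
def parityColoring (s : ZMod n) (v : ZMod n) : Fin 3 :=
  if v = 0 ∨ v = 2 ∨ v = s then 2 else if (v.cast : ZMod 2) = 0 then 0 else 1

/-- Adding `a` flips parity, so a conflict can occur only between two marked vertices. -/
theorem parityColoring_add_ne [NeZero n] (h2 : 2 ∣ n) (s a : ZMod n)
    (ha : (a.cast : ZMod 2) = 1) (hD : ∀ x y : ZMod n, (x = 0 ∨ x = 2 ∨ x = s) →
      (y = 0 ∨ y = 2 ∨ y = s) → y - x ≠ a) (v : ZMod n) :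
    parityColoring s (v + a) ≠ parityColoring s v := by
  unfold parityColoring
  have h := hD v (v + a)
  have hva : ((v + a).cast : ZMod 2) = v.cast + 1 := by rw [ZMod.cast_add h2, ha]
  rw [hva]
  have : ∀ z : ZMod 2, z = 0 ↔ ¬ (z + 1 = 0) := by decide
  have := this (v.cast : ZMod 2)
  by_cases h3 : v = 0 ∨ v = 2 ∨ v = s <;> by_cases h4 : v + a = 0 ∨ v + a = 2 ∨ v + a = s
  · exact absurd (by ring) (h h3 h4)
  · simp only [h3, h4, if_true, if_false]; split_ifs <;> decide
  · simp only [h3, h4, if_true, if_false]; split_ifs <;> decide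
  · simp only [h3, h4, if_false]; split_ifs <;> first | decide | tauto

theorem distinguishinglyColorable_three_of_even {k : ℕ} (hk : 3 < k) (hkn : 2 * k < n)
    (hne : n ≠ 2 * k + 2) (h2 : 2 ∣ n)
    (hsq : (k : ZMod n) ^ 2 = 1 ∨ (k : ZMod n) ^ 2 = -1) :
    (circulantOneK n k).DistinguishinglyColorable 3 := by
  have : NeZero n := ⟨by omega⟩
  have hkodd : k % 2 = 1 := by
    have hd : (2 : ℤ) ∣ (k : ℤ) ^ 2 - 1 ∨ (2 : ℤ) ∣ (k : ℤ) ^ 2 + 1 := by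
      have h2' : (2 : ℤ) ∣ n := by exact_mod_cast h2
      refine hsq.imp (fun h => h2'.trans ?_) (fun h => h2'.trans ?_)
      · rw [← ZMod.intCast_zmod_eq_zero_iff_dvd]; push_cast; rw [h]; ring
      · rw [← ZMod.intCast_zmod_eq_zero_iff_dvd]; push_cast; rw [h]; ring
    by_contra hk0
    obtain ⟨m, rfl⟩ : 2 ∣ k := by omega
    have e : ((2 * m : ℕ) : ℤ) ^ 2 = 2 * (2 * (m : ℤ) ^ 2) := by push_cast; ring
    rw [e] at hd
    omega
  have e (z : ℤ) (h1 : -2 * n < z) (h2 : z < 2 * n) (h : (z : ZMod n) = 0) :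
      z = 0 ∨ z = n ∨ z = -n := by
    by_contra! hz
    rcases lt_or_gt_of_ne hz.1 with h0 | h0
    · exact intCast_zmod_ne_zero (n := n) (-z) (by omega) (by omega) (by omega) (by simp [h])
    · exact intCast_zmod_ne_zero z h0 h2 hz.2.1 h
  -- The conditions make `{0, 2, s}` independent and `s` odd; `2s - 2 ≠ n` prevents the reflection
  -- `v ↦ 2 - v` from fixing `s`.
  obtain ⟨s, hs, hsn, hsk, hsk2, hs', hs'2, hs1, hsn1, hs2⟩ : ∃ s : ℕ, 5 ≤ s ∧ s < n ∧ s ≠ k ∧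
      s ≠ k + 2 ∧ s + k ≠ n ∧ s + k ≠ n + 2 ∧ 2 * s - 2 ≠ n ∧ s + 1 ≠ n ∧ s % 2 = 1 := by
    by_cases hk5 : k = 5
    · subst hk5
      have h14 : n ≠ 14 := by rintro rfl; revert hsq; decide
      have h16 : n ≠ 16 := by rintro rfl; revert hsq; decide
      exact ⟨9, by omega⟩
    · exact ⟨5, by omega⟩
  let π := ZMod.castHom h2 (ZMod 2)
  have hπ (v : ZMod n) : (v.cast : ZMod 2) = π v := rfl
  have hπk : π k = 1 := by
    rw [map_natCast]; exact (ZMod.natCast_eq_one_iff_odd).2 (Nat.odd_iff.2 hkodd)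
  have hπs : π s = 1 := by
    rw [map_natCast]; exact (ZMod.natCast_eq_one_iff_odd).2 (Nat.odd_iff.2 hs2)
  have hπa {a : ZMod n} (ha : IsStep (k : ZMod n) a) : π a = 1 := by
    rcases ha with rfl | rfl | rfl | rfl <;> simp [hπk]
  have lift (x : ZMod n) (hx : x = 0 ∨ x = 2 ∨ x = s) :
      ∃ X : ℤ, (X = 0 ∨ X = 2 ∨ X = s) ∧ (X : ZMod n) = x := by
    rcases hx with rfl | rfl | rfl
    · exact ⟨0, by simp⟩
    · exact ⟨2, by simp⟩
    · exact ⟨s, by simp⟩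
  refine distinguishinglyColorable_of_forall hk hkn hne (parityColoring (s : ZMod n))
    (parityColoring_add_ne h2 _ _ (map_one π) ?_) (parityColoring_add_ne h2 _ _ hπk ?_)
    fun a c ha h => ?_
  · intro x y hx hy h
    obtain ⟨X, hX, rfl⟩ := lift x hx
    obtain ⟨Y, hY, rfl⟩ := lift y hy
    have := e (Y - X - 1) (by omega) (by omega) (by push_cast; linear_combination h)
    omega
  · intro x y hx hy h
    obtain ⟨X, hX, rfl⟩ := lift x hx
    obtain ⟨Y, hY, rfl⟩ := lift y hy
    have := e (Y - X - k) (by omega) (by omega) (by push_cast; linear_combination h)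
    omega
  · have hS (v : ZMod n) : parityColoring (s : ZMod n) v = 2 ↔ v = 0 ∨ v = 2 ∨ v = s := by
      unfold parityColoring; split_ifs <;> simp_all
    have hS' (v : ZMod n) (hv : v = 0 ∨ v = 2 ∨ v = s) :
        c + a * v = 0 ∨ c + a * v = 2 ∨ c + a * v = s := by rw [← hS, h, hS]; exact hv
    -- Vertex 1 has color 1, so its image `c + a` is odd; as `a` is odd, `c` is even. Parity is thus
    -- preserved, so `s` is fixed and `{0, 2}` is permuted.
    have hc : π c = 0 := by
      have h1 : parityColoring (s : ZMod n) 1 = 1 := by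
        unfold parityColoring
        rw [hπ, map_one, if_neg ?_, if_neg (by decide)]
        intro h1
        obtain ⟨X, hX, hX1⟩ := lift 1 h1
        have := e (X - 1) (by omega) (by omega) (by simp [hX1])
        omega
      have h2 := h 1
      rw [h1] at h2
      unfold parityColoring at h2
      rw [hπ, mul_one, map_add, hπa ha] at h2
      split_ifs at h2 with h3 h4
      · exact absurd h2 (by decide)
      · exact absurd h2 (by decide)
      · revert h4; generalize π c = z; revert z; decide
    have hc' : c = 0 ∨ c = 2 := by
      have := hS' 0 (Or.inl rfl)
      rw [mul_zero, add_zero] at this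
      refine this.imp_right fun h => h.resolve_right ?_
      rintro rfl
      rw [hπs] at hc; exact absurd hc (by decide)
    have hs3 : c + a * s = s := by
      have hπcs : π (c + a * s) = 1 := by simp [hc, hπa ha, hπs]
      rcases hS' s (by simp) with h | h | h
      · rw [h, map_zero] at hπcs; exact absurd hπcs (by decide)
      · rw [h, map_ofNat] at hπcs; exact absurd hπcs (by decide)
      · exact h
    have h2' : c + a * 2 = 0 ∨ c + a * 2 = 2 := by
      have hπc2 : π (c + a * 2) = 0 := by
        rw [map_add, hc, map_mul, map_ofNat, hπa ha]; decide
      rcases hS' 2 (by simp) with h | h | h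
      · exact Or.inl h
      · exact Or.inr h
      · rw [h, hπs] at hπc2; exact absurd hπc2 (by decide)
    obtain ⟨A, hA, rfl⟩ : ∃ A : ℤ, (A = 1 ∨ A = -1 ∨ A = k ∨ A = -k) ∧ (A : ZMod n) = a := by
      rcases ha with rfl | rfl | rfl | rfl
      · exact ⟨1, by simp⟩
      · exact ⟨-1, by simp⟩
      · exact ⟨k, by simp⟩
      · exact ⟨-k, by simp⟩
    obtain ⟨C, hC, rfl⟩ : ∃ C : ℤ, (C = 0 ∨ C = 2) ∧ (C : ZMod n) = c := by
      rcases hc' with rfl | rfl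
      · exact ⟨0, by simp⟩
      · exact ⟨2, by simp⟩
    have hAC : (A = 1 ∧ C = 0) ∨ (A = -1 ∧ C = 2) := by
      rcases h2' with h2' | h2'
      · have := e (C + A * 2) (by omega) (by omega) (by push_cast; linear_combination h2')
        omega
      · have := e (C + A * 2 - 2) (by omega) (by omega) (by push_cast; linear_combination h2')
        omega
    rcases hAC with ⟨rfl, rfl⟩ | ⟨rfl, rfl⟩
    · simp
    · have := e (2 * s - 2) (by omega) (by omega) (by push_cast at hs3 ⊢; linear_combination -hs3)
      omega

end Even

/-! ### Odd `n` with `k² = 1`: a product of two odd cycles -/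

section Torus

/-- A coloring of the direct product of two odd cycles, of lengths `p` and `q`. -/
def torusColoring {p q : ℕ} (x : ZMod p) (y : ZMod q) : Fin 3 :=
  if y.val = 0 ∨ (y.val = 2 ∧ x = 0) ∨ (y.val = 4 ∧ x = 1) then 2
  else if y.val % 2 = 1 then 0 else 1

variable {p q : ℕ}

/-- Row 0 has color 2 and the other rows alternate. The altered vertices lie in rows 2 and 4, and
the adjacent rows 1, 3, 5 avoid color 2 because `q ≥ 7`. -/
theorem torusColoring_add_one_ne (hq : 7 ≤ q) (hqodd : q % 2 = 1) (x x' : ZMod p) (y : ZMod q) :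
    torusColoring x' (y + 1) ≠ torusColoring x y := by
  have : NeZero q := ⟨by omega⟩
  have hy := y.val_lt
  have h1 : (y + 1).val = if y.val + 1 = q then 0 else y.val + 1 := by
    have h := ZMod.val_add y 1
    rw [ZMod.val_one'' (by omega)] at h
    rw [h]
    split_ifs with h'
    · rw [h', Nat.mod_self]
    · exact Nat.mod_eq_of_lt (by omega)
  unfold torusColoring
  generalize y.val = m at *
  rw [h1]
  by_cases hm : m + 1 = q
  · have : m ≠ 0 ∧ m ≠ 2 ∧ m ≠ 4 ∧ m % 2 = 0 := by omega
    simp [this, hm]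
  · by_cases h0 : m = 0
    · simp [h0, show 1 ≠ q by omega]
    · rw [if_neg hm]
      rcases Nat.mod_two_eq_zero_or_one m with h | h
      · have : m + 1 ≠ 0 ∧ m + 1 ≠ 2 ∧ m + 1 ≠ 4 ∧ (m + 1) % 2 = 1 := by omega
        simp [this, h]
        split_ifs <;> decide
      · have : m ≠ 0 ∧ m ≠ 2 ∧ m ≠ 4 ∧ (m + 1) % 2 = 0 := by omega
        simp [this, h]
        split_ifs <;> decide

/-- Row 0 is the only row entirely of color 2, so `d = 0`; rows 1 and `q - 1` differ in color, so `β
= 1`. The altered vertices `(0, 2)` and `(1, 4)` are alone with color 2 in their rows, giving `c =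
0` and then `α = 1`. -/
theorem torusColoring_affine (hp : 3 ≤ p) (hq : 7 ≤ q) (hqodd : q % 2 = 1) {α c : ZMod p}
    {β d : ZMod q} (hα : α = 1 ∨ α = -1) (hβ : β = 1 ∨ β = -1)
    (h : ∀ x y, torusColoring (c + α * x) (d + β * y) = torusColoring x y) :
    c = 0 ∧ α = 1 ∧ d = 0 ∧ β = 1 := by
  have : NeZero q := ⟨by omega⟩
  have : Fact (1 < p) := ⟨by omega⟩
  have hα2 : α * α = 1 := by rcases hα with rfl | rfl <;> ring
  have h10 : (1 : ZMod p) ≠ 0 := one_ne_zero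
  have h11 : (-1 : ZMod p) ≠ 1 := by
    intro h
    exact intCast_zmod_ne_zero (n := p) 2 (by omega) (by omega) (by omega)
      (by push_cast; linear_combination -h)
  have v1 : (1 : ZMod q).val = 1 := ZMod.val_one'' (by omega)
  have v2 : (2 : ZMod q).val = 2 := by
    simpa using ZMod.val_natCast_of_lt (n := q) (a := 2) (by omega)
  have v4 : (4 : ZMod q).val = 4 := by
    simpa using ZMod.val_natCast_of_lt (n := q) (a := 4) (by omega)
  have vm : (-1 : ZMod q).val = q - 1 := by
    have := ZMod.val_natCast_of_lt (n := q) (a := q - 1) (by omega)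
    rwa [Nat.cast_sub (by omega), ZMod.natCast_self, Nat.cast_one, zero_sub] at this
  have hd : d = 0 := by
    have hx (x : ZMod p) : torusColoring x d = 2 := by
      have := h (α * (x - c)) 0
      rw [show c + α * (α * (x - c)) = x by linear_combination (x - c) * hα2, mul_zero,
        add_zero] at this
      rw [this]; simp [torusColoring]
    by_contra hd
    have hd' : d.val ≠ 0 := by simpa using hd
    have a0 := hx 0
    have a1 := hx 1
    have n01 : (0 : ZMod p) ≠ 1 := h10.symm
    unfold torusColoring at a0 a1
    simp only [hd', h10, n01, and_false, and_true, false_or, or_false] at a0 a1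
    by_cases h2 : d.val = 2
    · simp [h2] at a1
    · rw [if_neg h2] at a0
      revert a0; split_ifs <;> decide
  subst hd
  simp only [zero_add] at h
  have hβ1 : β = 1 := by
    refine hβ.resolve_right ?_
    rintro rfl
    have := h 0 1
    rw [mul_one] at this
    unfold torusColoring at this
    rw [vm, v1] at this
    have e : q - 1 ≠ 0 ∧ q - 1 ≠ 2 ∧ q - 1 ≠ 4 ∧ (q - 1) % 2 = 0 := by omega
    simp [e] at this
  subst hβ1
  simp only [one_mul] at h
  have hc : c = 0 := by
    have := h 0 2
    by_contra hc
    simp [torusColoring, v2, hc] at this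
  subst hc
  refine ⟨rfl, hα.resolve_right ?_, rfl, rfl⟩
  rintro rfl
  have := h 1 4
  simp [torusColoring, v4, h11] at this

theorem distinguishinglyColorable_three_of_coprime_mul {n k : ℕ} (hk : 3 < k) (hkn : 2 * k < n)
    (hne : n ≠ 2 * k + 2) (hn : n = p * q) (hpq : p.Coprime q) (hp : 3 ≤ p) (hq : 7 ≤ q)
    (hqodd : q % 2 = 1) (hkp : (k : ZMod p) = 1 ∨ (k : ZMod p) = -1)
    (hkq : (k : ZMod q) = 1 ∨ (k : ZMod q) = -1) :
    (circulantOneK n k).DistinguishinglyColorable 3 := by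
  let e : ZMod n ≃+* ZMod p × ZMod q := (ZMod.ringEquivCongr hn).trans (ZMod.chineseRemainder hpq)
  have hstep1 {a : ZMod n} (ha : IsStep (k : ZMod n) a) : (e a).1 = 1 ∨ (e a).1 = -1 := by
    rcases ha with rfl | rfl | rfl | rfl <;> simp <;> rcases hkp with h | h <;> simp [h]
  have hstep2 {a : ZMod n} (ha : IsStep (k : ZMod n) a) : (e a).2 = 1 ∨ (e a).2 = -1 := by
    rcases ha with rfl | rfl | rfl | rfl <;> simp <;> rcases hkq with h | h <;> simp [h]
  have proper (x x' : ZMod p) (y b : ZMod q) (hb : b = 1 ∨ b = -1) :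
      torusColoring x' (y + b) ≠ torusColoring x y := by
    rcases hb with rfl | rfl
    · exact torusColoring_add_one_ne hq hqodd x x' y
    · have := torusColoring_add_one_ne hq hqodd x' x (y + -1)
      rw [neg_add_cancel_right] at this
      exact this.symm
  refine distinguishinglyColorable_of_forall hk hkn hne
    (fun v => torusColoring (e v).1 (e v).2) (fun v => ?_) (fun v => ?_) fun a c ha h => ?_
  · simpa using proper (e v).1 (e (v + 1)).1 (e v).2 1 (Or.inl rfl)
  · simpa using proper (e v).1 (e (v + k)).1 (e v).2 k hkq
  · obtain ⟨h1, h2, h3, h4⟩ := torusColoring_affine hp hq hqodd (hstep1 ha) (hstep2 ha)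
      (c := (e c).1) (d := (e c).2) fun x y => by simpa using h (e.symm (x, y))
    exact ⟨e.injective (Prod.ext (by simpa using h2) (by simpa using h4)),
      e.injective (Prod.ext (by simpa using h1) (by simpa using h3))⟩

theorem distinguishinglyColorable_three_of_sq_eq_one {n k : ℕ} (hk : 3 < k) (hkn : 2 * k < n)
    (hne : n ≠ 2 * k + 2) (hodd : n % 2 = 1) (hsq : (k : ZMod n) ^ 2 = 1)
    (h15 : ¬ (n = 15 ∧ k = 4)) : (circulantOneK n k).DistinguishinglyColorable 3 := by
  obtain ⟨j, rfl⟩ : ∃ j, k = j + 1 := ⟨k - 1, by omega⟩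
  have hdvd : n ∣ j * (j + 2) := by
    rw [← ZMod.natCast_eq_zero_iff]
    push_cast at hsq ⊢
    linear_combination hsq
  obtain ⟨p, q, hp, hq, hn⟩ := exists_dvd_and_dvd_of_dvd_mul hdvd
  have hpn : p ∣ n := ⟨q, hn⟩
  have hqn : q ∣ n := ⟨p, by rw [hn, mul_comm]⟩
  have hpodd : p % 2 = 1 := Nat.odd_iff.1 ((Nat.odd_iff.2 hodd).of_dvd_nat hpn)
  have hqodd : q % 2 = 1 := Nat.odd_iff.1 ((Nat.odd_iff.2 hodd).of_dvd_nat hqn)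
  have hpq : p.Coprime q := by
    have h2 : p.gcd q ∣ 2 :=
      (Nat.dvd_add_right ((Nat.gcd_dvd_left p q).trans hp)).1 ((Nat.gcd_dvd_right p q).trans hq)
    rcases (Nat.dvd_prime Nat.prime_two).1 h2 with h | h
    · exact h
    · have := h ▸ Nat.gcd_dvd_left p q
      omega
  have hkp : ((j + 1 : ℕ) : ZMod p) = 1 := by
    have := (ZMod.natCast_eq_zero_iff j p).2 hp
    push_cast; rw [this, zero_add]
  have hkq : ((j + 1 : ℕ) : ZMod q) = -1 := by
    have := (ZMod.natCast_eq_zero_iff (j + 2) q).2 hq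
    push_cast at this ⊢; linear_combination this
  have hp3 : p ≠ 1 := by
    rintro rfl
    have := Nat.le_of_dvd (by omega) hq
    omega
  have hq3 : q ≠ 1 := by
    rintro rfl
    have := Nat.le_of_dvd (by omega) hp
    omega
  by_cases hq7 : 7 ≤ q
  · exact distinguishinglyColorable_three_of_coprime_mul hk hkn hne hn hpq (by omega) hq7 hqodd
      (Or.inl hkp) (Or.inr hkq)
  by_cases hp7 : 7 ≤ p
  · exact distinguishinglyColorable_three_of_coprime_mul hk hkn hne (by rw [hn, mul_comm])
      hpq.symm (by omega) hp7 hpodd (Or.inr hkq) (Or.inl hkp)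
  -- Of the remaining small factorizations only `p = 3`, `q = 5` is consistent, and it forces `k =
  -- 4`.
  have hp' : p = 3 ∨ p = 5 := by omega
  have hq' : q = 3 ∨ q = 5 := by omega
  rcases hp' with rfl | rfl <;> rcases hq' with rfl | rfl <;> omega

end Torus

/-! ### Odd `n` with `k² = -1`: three arcs and Thue's lemma -/

section Arcs

/-- The coloring of the cyclic group `ZMod n` by three consecutive arcs of length about `n / 3`. -/
def arcColoring {n : ℕ} (y : ZMod n) : Fin 3 :=
  if 3 * y.val < n then 0 else if 3 * y.val < 2 * n then 1 else 2

variable {n k : ℕ}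

theorem arcColoring_add_ne [NeZero n] {R : ℕ} (h1 : n ≤ 3 * R) (h2 : 3 * R ≤ 2 * n) (y : ZMod n) :
    arcColoring (y + (R : ZMod n)) ≠ arcColoring y := by
  have hn : 0 < n := NeZero.pos n
  have hy := y.val_lt
  have hv : (y + (R : ZMod n)).val = if y.val + R < n then y.val + R else y.val + R - n := by
    rw [ZMod.val_add, ZMod.val_natCast_of_lt (by omega)]
    split_ifs with h
    · exact Nat.mod_eq_of_lt h
    · rw [Nat.mod_eq_sub_mod (by omega), Nat.mod_eq_of_lt (by omega)]
  unfold arcColoring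
  rw [hv]
  generalize y.val = m at *
  split_ifs <;> first | decide | omega

/-- The image `c` of `0` must stay in the first arc and the image `c - a` of `-1` in the last. For
`a = 1` this means `c = 0`; for `a = -1`, `c + 1` is too small. -/
theorem arcColoring_affine (hn : 3 ≤ n) {a c : ZMod n} (ha : a = 1 ∨ a = -1)
    (h : ∀ y, arcColoring (c + a * y) = arcColoring y) : a = 1 ∧ c = 0 := by
  have : NeZero n := ⟨by omega⟩
  have hc := c.val_lt
  have v1 : (1 : ZMod n).val = 1 := ZMod.val_one'' (by omega)
  have vm : (-1 : ZMod n).val = n - 1 := by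
    have := ZMod.val_natCast_of_lt (n := n) (a := n - 1) (by omega)
    rwa [Nat.cast_sub (by omega), ZMod.natCast_self, Nat.cast_one, zero_sub] at this
  have h0 := h 0
  have hm := h (-1)
  have col0 : arcColoring (0 : ZMod n) = 0 := by
    unfold arcColoring; rw [ZMod.val_zero, if_pos (by omega)]
  have colm : arcColoring (-1 : ZMod n) = 2 := by
    unfold arcColoring; rw [vm, if_neg (by omega), if_neg (by omega)]
  rw [mul_zero, add_zero, col0] at h0
  have hc3 : 3 * c.val < n := by
    unfold arcColoring at h0
    split_ifs at h0 with h1 h2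
    · exact h1
    all_goals exact absurd h0 (by decide)
  rw [colm] at hm
  have key (z : ZMod n) (hz : arcColoring z = 2) : 2 * n ≤ 3 * z.val := by
    unfold arcColoring at hz
    split_ifs at hz with h1 h2
    · exact absurd hz (by decide)
    · exact absurd hz (by decide)
    · omega
  have hm' := key _ hm
  rcases ha with rfl | rfl
  · refine ⟨rfl, ?_⟩
    by_contra hc0
    have hc0' : c.val ≠ 0 := by simpa using hc0
    rw [one_mul, ZMod.val_add, vm, show c.val + (n - 1) = c.val - 1 + n by omega, Nat.add_mod_right,
      Nat.mod_eq_of_lt (by omega)] at hm'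
    omega
  · rw [mul_neg, mul_one, neg_neg, ZMod.val_add, v1, Nat.mod_eq_of_lt (by omega)] at hm'
    omega

theorem distinguishinglyColorable_three_of_isUnit (hk : 3 < k) (hkn : 2 * k < n)
    (hne : n ≠ 2 * k + 2) (hsq : (k : ZMod n) ^ 2 = -1) {R R' : ℕ} (hR : IsUnit (R : ZMod n))
    (hRR' : (R : ZMod n) * k = R') (h1 : n ≤ 3 * R) (h2 : 3 * R ≤ 2 * n) (h1' : n ≤ 3 * R')
    (h2' : 3 * R' ≤ 2 * n) : (circulantOneK n k).DistinguishinglyColorable 3 := by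
  have : NeZero n := ⟨by omega⟩
  obtain ⟨u, hu⟩ := hR.exists_right_inv
  refine distinguishinglyColorable_of_forall hk hkn hne (fun v => arcColoring ((R : ZMod n) * v))
    (fun v => ?_) (fun v => ?_) fun a c ha h => ?_
  · simp only [mul_add, mul_one]; exact arcColoring_add_ne h1 h2 _
  · simp only [mul_add, hRR']; exact arcColoring_add_ne h1' h2' _
  · have h' (y : ZMod n) : arcColoring ((R : ZMod n) * c + a * y) = arcColoring y := by
      have := h (u * y)
      rwa [show (R : ZMod n) * (c + a * (u * y)) = R * c + a * y by linear_combination a * y * hu,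
        show (R : ZMod n) * (u * y) = y by linear_combination y * hu] at this
    have ha' : (a = 1 ∨ a = -1) ∨ a * a = -1 := by
      rcases ha with ha | ha | rfl | rfl
      · exact Or.inl (Or.inl ha)
      · exact Or.inl (Or.inr ha)
      · right; rw [← hsq]; ring
      · right; rw [← hsq]; ring
    rcases ha' with ha' | ha'
    · obtain ⟨rfl, hc⟩ := arcColoring_affine (by omega) ha' h'
      exact ⟨rfl, hR.mul_right_eq_zero.1 hc⟩
    -- For `a = ±k` the square of the map has linear part `-1`, which was just excluded.
    · have := (arcColoring_affine (n := n) (by omega) (a := a * a) (c := R * c + a * (R * c))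
        (Or.inr ha') fun y => by
          rw [show (R : ZMod n) * c + a * (R * c) + a * a * y = R * c + a * (R * c + a * y) by ring,
            h', h']).1
      rw [ha'] at this
      exact absurd (show ((2 : ℤ) : ZMod n) = 0 by push_cast; linear_combination -this)
        (intCast_zmod_ne_zero 2 (by omega) (by omega) (by omega))

/-- Thue's lemma for a square root `k` of `-1` modulo an odd number `n`. -/
theorem exists_sq_add_sq_eq_of_sq_eq_neg_one (hn : 9 ≤ n) (hodd : n % 2 = 1)
    (hsq : (k : ZMod n) ^ 2 = -1) :
    ∃ a b : ℤ, a ^ 2 + b ^ 2 = n ∧ (a : ZMod n) = k * b ∧ IsUnit (b : ZMod n) := by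
  have : NeZero n := ⟨by omega⟩
  obtain ⟨a, b, hab, ha, hb, hkab⟩ : ∃ a b : ℤ, (a ≠ 0 ∨ b ≠ 0) ∧ a ^ 2 ≤ n ∧ b ^ 2 ≤ n ∧
      (a : ZMod n) = k * b := by
    let f : Fin (n.sqrt + 1) × Fin (n.sqrt + 1) → ZMod n := fun x => (x.1 : ℕ) - k * (x.2 : ℕ)
    obtain ⟨⟨i, j⟩, ⟨i', j'⟩, hne, hf⟩ := Fintype.exists_ne_map_eq_of_card_lt f (by
      simpa [ZMod.card] using Nat.lt_succ_sqrt n)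
    have bound (i i' : Fin (n.sqrt + 1)) : ((i : ℤ) - (i' : ℤ)) ^ 2 ≤ n := by
      have h : ((n.sqrt : ℤ)) * n.sqrt ≤ n := by exact_mod_cast Nat.sqrt_le n
      have := i.2
      have := i'.2
      nlinarith
    refine ⟨(i : ℤ) - (i' : ℤ), (j : ℤ) - (j' : ℤ), ?_, bound i i', bound j j', ?_⟩
    · by_contra! h0
      exact hne (Prod.ext (Fin.ext (by simp only; omega)) (Fin.ext (by simp only; omega)))
    · simp only [f] at hf
      push_cast
      linear_combination hf
  obtain ⟨w, hw⟩ : (n : ℤ) ∣ (k : ℤ) ^ 2 + 1 := by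
    rw [← ZMod.intCast_zmod_eq_zero_iff_dvd]; push_cast; rw [hsq]; ring
  obtain ⟨u, hu⟩ : (n : ℤ) ∣ a - k * b := by
    rw [← ZMod.intCast_zmod_eq_zero_iff_dvd]; push_cast; rw [hkab]; ring
  have hsum : a ^ 2 + b ^ 2 = n * (b * (b * w + 2 * k * u) + n * u ^ 2) := by
    rw [show a = k * b + n * u by linear_combination hu]
    linear_combination b ^ 2 * hw
  -- This form of `z` shows that `z = 1` makes `b` a unit modulo `n`. If `z = 2`, then `a² = b² =
  -- n`, so `b ∣ 2`, contradicting `n ≥ 9`.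
  set z := b * (b * w + 2 * k * u) + n * u ^ 2 with hz
  have hn0 : (0 : ℤ) < n := by omega
  have hz0 : 0 < z := by
    have : 0 < a ^ 2 + b ^ 2 := by rcases hab with h | h <;> positivity
    nlinarith
  have hz2 : z ≤ 2 := by nlinarith
  have hz1 : z ≠ 2 := by
    intro h2
    have hbn : b * b = n := by nlinarith
    have hdvd : b ∣ 2 := by
      rw [← h2, hz, ← hbn]
      exact ⟨b * w + 2 * k * u + b * u ^ 2, by ring⟩
    have := Int.le_of_dvd (by norm_num) hdvd
    have := Int.le_of_dvd (by norm_num) ((neg_dvd).2 hdvd)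
    nlinarith
  have hz' : z = 1 := by omega
  refine ⟨a, b, by rw [hsum, hz', mul_one], hkab, ?_⟩
  refine IsUnit.of_mul_eq_one ((b * w + 2 * k * u : ℤ) : ZMod n) ?_
  have := congrArg (Int.cast : ℤ → ZMod n) (hz.symm.trans hz')
  push_cast at this ⊢
  rw [ZMod.natCast_self] at this
  linear_combination this

theorem distinguishinglyColorable_three_of_sq_eq_neg_one (hk : 3 < k) (hkn : 2 * k < n)
    (hne : n ≠ 2 * k + 2) (hodd : n % 2 = 1) (hsq : (k : ZMod n) ^ 2 = -1) (h13 : n ≠ 13) :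
    (circulantOneK n k).DistinguishinglyColorable 3 := by
  obtain ⟨a, b, hab, hkab, hb⟩ := exists_sq_add_sq_eq_of_sq_eq_neg_one (by omega) hodd hsq
  have h2 : IsUnit (2 : ZMod n) := by
    have := (ZMod.isUnit_iff_coprime 2 n).2 ((Nat.coprime_two_left).2 (Nat.odd_iff.2 hodd))
    exact_mod_cast this
  have ht : IsUnit ((a - b : ℤ) : ZMod n) := by
    have hk1 : IsUnit ((k : ZMod n) - 1) := by
      refine isUnit_of_mul_isUnit_left (y := -((k : ZMod n) + 1)) ?_
      convert h2 using 1
      linear_combination -hsq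
    convert hk1.mul hb using 1
    push_cast
    linear_combination hkab
  have hparity : (a + b) % 2 = 1 := by
    have h : a ^ 2 % 2 = a % 2 := by
      rcases Int.emod_two_eq_zero_or_one a with h | h <;> simp [pow_two, Int.mul_emod, h]
    have h' : b ^ 2 % 2 = b % 2 := by
      rcases Int.emod_two_eq_zero_or_one b with h | h <;> simp [pow_two, Int.mul_emod, h]
    omega
  -- Among odd sums `n = a² + b² ≥ 9` this fails only for `13 = 2² + 3²`.
  have hbound : 3 * (|a| + |b|) ≤ n := by
    rw [← sq_abs a, ← sq_abs b] at hab
    have ha0 := abs_nonneg a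
    have hb0 := abs_nonneg b
    generalize |a| = x at *
    generalize |b| = y at *
    by_cases hx : 4 ≤ x
    · nlinarith [mul_nonneg hb0 hb0, sq_nonneg (2 * y - 3)]
    by_cases hy : 4 ≤ y
    · nlinarith [sq_nonneg (2 * x - 3)]
    · have hx' : x ≤ 3 := by omega
      have hy' : y ≤ 3 := by omega
      interval_cases x <;> interval_cases y <;> omega
  have ha1 := neg_abs_le a
  have ha2 := le_abs_self a
  have hb1 := neg_abs_le b
  have hb2 := le_abs_self b
  -- Modulo `n`, `2R = -(a - b)` and `k a = -b`, so `2Rk = a + b = 2R'`. `hbound` puts `R` and `R'`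
  -- between `n / 3` and `2n / 3`.
  obtain ⟨R, hR⟩ : ∃ R : ℕ, 2 * (R : ℤ) = n - (a - b) := ⟨((n - (a - b)) / 2).toNat, by omega⟩
  obtain ⟨R', hR'⟩ : ∃ R' : ℕ, 2 * (R' : ℤ) = n + (a + b) := ⟨((n + (a + b)) / 2).toNat, by omega⟩
  have e1 := congrArg (Int.cast : ℤ → ZMod n) hR
  have e2 := congrArg (Int.cast : ℤ → ZMod n) hR'
  push_cast at e1 e2 ht
  rw [ZMod.natCast_self] at e1 e2
  refine distinguishinglyColorable_three_of_isUnit hk hkn hne hsq (R := R) (R' := R') ?_ ?_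
    (by omega) (by omega) (by omega) (by omega)
  · refine isUnit_of_mul_isUnit_right (x := 2) ?_
    rw [e1, zero_sub]
    exact ht.neg
  · refine h2.mul_left_cancel ?_
    rw [e2]
    linear_combination k * e1 - (1 + k) * hkab - b * hsq

end Arcs

/-! ### The exceptional graphs, by computation -/

section Small

/-- Backtracking search: every extension of the list `l` of colors (latest first) by `m` colors,
each new color `c` admissible after the colors `l'` preceding it, satisfies `P`. -/
def forallExtensions (ok : ℕ → List ℕ → Bool) (P : List ℕ → Bool) : ℕ → List ℕ → Bool
  | 0, l => P l
  | m + 1, l => (!ok 0 l || forallExtensions ok P m (0 :: l)) &&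
      ((!ok 1 l || forallExtensions ok P m (1 :: l)) &&
        (!ok 2 l || forallExtensions ok P m (2 :: l)))

/-- The list `[f (m - 1), …, f 0]`. -/
def revValues (f : ℕ → ℕ) : ℕ → List ℕ
  | 0 => []
  | m + 1 => f m :: revValues f m

theorem revValues_getD (f : ℕ → ℕ) (m i : ℕ) (hi : i < m) (d : ℕ) :
    (revValues f m).getD i d = f (m - 1 - i) := by
  induction m generalizing i with
  | zero => omega
  | succ m ih =>
    cases i with
    | zero => simp [revValues]
    | succ i =>
      simp only [revValues, List.getD_cons_succ]
      rw [ih i (by omega)]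
      congr 1; omega

theorem revValues_getD_of_le (f : ℕ → ℕ) (m i : ℕ) (hi : m ≤ i) (d : ℕ) :
    (revValues f m).getD i d = d := by
  induction m generalizing i with
  | zero => simp [revValues]
  | succ m ih =>
    cases i with
    | zero => omega
    | succ i => simp only [revValues, List.getD_cons_succ]; exact ih i (by omega)

theorem forallExtensions_spec {ok : ℕ → List ℕ → Bool} {P : List ℕ → Bool} (f : ℕ → ℕ)
    (hf : ∀ i, f i < 3) (hok : ∀ i, ok (f i) (revValues f i) = true) (m j : ℕ)
    (h : forallExtensions ok P m (revValues f j) = true) : P (revValues f (j + m)) = true := by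
  induction m generalizing j with
  | zero => exact h
  | succ m ih =>
    rw [← add_assoc, add_right_comm]
    apply ih (j + 1)
    simp only [forallExtensions, Bool.and_eq_true, Bool.or_eq_true, Bool.not_eq_true'] at h
    have h1 := hok j
    have h2 := hf j
    simp only [revValues]
    interval_cases f j <;> simp_all

/-- Whether the color `c` differs from those of the vertices at distance `1` and `k` before. -/
def admissible (k c : ℕ) (l : List ℕ) : Bool :=
  !(l.getD 0 3 == c) && !(l.getD (k - 1) 3 == c)

/-- Whether a coloring of `ZMod n`, given by the list of its values, is invariant under
`v ↦ c + a * v`. -/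
def invariantUnder (n a c : ℕ) (l : List ℕ) : Bool :=
  (List.range n).all fun v => l.getD (n - 1 - (c + a * v) % n) 3 == l.getD (n - 1 - v) 3

theorem forall_of_forallExtensions {n k : ℕ} [NeZero n] (hk : 0 < k) {P : List ℕ → Bool}
    (h : forallExtensions (admissible k) P n [] = true) (f : ZMod n → Fin 3)
    (h1 : ∀ v, f (v + 1) ≠ f v) (hf : ∀ v, f (v + k) ≠ f v) :
    P (revValues (fun i => (f i : ℕ)) n) = true := by
  have := forallExtensions_spec (ok := admissible k) (P := P) (fun i => (f i : ℕ))
    (fun i => (f i).2) (fun i => ?_) n 0 h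
  · simpa using this
  · have key (j : ℕ) (hj : 0 < j) (hfj : ∀ v, f (v + j) ≠ f v) :
        (revValues (fun i => (f i : ℕ)) i).getD (j - 1) 3 ≠ f i := by
      rcases le_or_gt j i with hji | hji
      · rw [revValues_getD _ _ _ (by omega)]
        have := hfj ((i - 1 - (j - 1) : ℕ) : ZMod n)
        rw [← Nat.cast_add, show i - 1 - (j - 1) + j = i by omega] at this
        exact fun h => this (Fin.ext h.symm)
      -- No earlier vertex is at distance `j`: the default 3 is not a color and never conflicts.
      -- Edges that wrap around are left to `hasConflict`.
      · rw [revValues_getD_of_le _ _ _ (by omega)]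
        have := (f i).2
        omega
    have k1 := key 1 one_pos (by simpa using h1)
    have k2 := key k hk hf
    simp only [admissible, Bool.and_eq_true, Bool.not_eq_true', beq_eq_false_iff_ne]
    exact ⟨k1, k2⟩

theorem revValues_getD_zmod {n : ℕ} [NeZero n] (f : ZMod n → ℕ) (i : ℕ) (hi : i < n) :
    (revValues (fun i => f i) n).getD (n - 1 - i) 3 = f i := by
  rw [revValues_getD _ _ _ (by omega), show n - 1 - (n - 1 - i) = i by omega]

theorem invariantUnder_spec {n a c : ℕ} [NeZero n] (f : ZMod n → Fin 3)
    (h : invariantUnder n a c (revValues (fun i => (f i : ℕ)) n) = true) (v : ZMod n) :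
    f (c + a * v) = f v := by
  have hn : 0 < n := NeZero.pos n
  have := List.all_eq_true.1 h v.val (List.mem_range.2 v.val_lt)
  rw [revValues_getD_zmod (fun i => (f i : ℕ)) _ (Nat.mod_lt _ hn),
    revValues_getD_zmod (fun i => (f i : ℕ)) _ v.val_lt, beq_iff_eq] at this
  simpa using Fin.ext this

/-- Whether a coloring of `ZMod n`, given by the list of its values, gives the same color to two
vertices at distance `d`. -/
def hasConflict (n d : ℕ) (l : List ℕ) : Bool :=
  (List.range n).any fun v => l.getD (n - 1 - (v + d) % n) 3 == l.getD (n - 1 - v) 3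

theorem hasConflict_eq_false {n d : ℕ} [NeZero n] (f : ZMod n → Fin 3)
    (h : ∀ v, f (v + d) ≠ f v) : hasConflict n d (revValues (fun i => (f i : ℕ)) n) = false := by
  rw [← Bool.not_eq_true]
  intro hc
  obtain ⟨v, hv, hvd⟩ := List.any_eq_true.1 hc
  rw [List.mem_range] at hv
  rw [beq_iff_eq, revValues_getD_zmod (fun i => (f i : ℕ)) _ (Nat.mod_lt _ (NeZero.pos n)),
    revValues_getD_zmod (fun i => (f i : ℕ)) _ hv] at hvd
  exact h v (Fin.ext (by simpa using hvd))

/-- A search certificate: if every list of `n` colors that survives the pruning is improper or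
invariant under one of the maps `v ↦ c + a * v` with `(a, c)` in `L`, so is every coloring. -/
theorem exists_invariant_of_forallExtensions {n k : ℕ} [NeZero n] (hk : 0 < k) (L : List (ℕ × ℕ))
    (h : forallExtensions (admissible k) (fun l => hasConflict n 1 l || hasConflict n k l ||
      L.any fun x => invariantUnder n x.1 x.2 l) n [] = true) (f : ZMod n → Fin 3)
    (h1 : ∀ v, f (v + 1) ≠ f v) (hf : ∀ v, f (v + k) ≠ f v) :
    ∃ x ∈ L, ∀ v, f (x.2 + x.1 * v) = f v := by
  have := forall_of_forallExtensions hk h f h1 hf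
  rw [hasConflict_eq_false f (by simpa using h1), hasConflict_eq_false f hf, Bool.false_or,
    Bool.false_or] at this
  obtain ⟨x, hx, h⟩ := List.any_eq_true.1 this
  exact ⟨x, hx, invariantUnder_spec f h⟩

theorem not_distinguishinglyColorable_three_thirteen :
    ¬ (circulantOneK 13 5).DistinguishinglyColorable 3 := by
  rintro ⟨C, -⟩
  have h1 := C.circulantOneK_add_ne (by norm_num) (by norm_num) (Or.inl rfl)
  have h5 := C.circulantOneK_add_ne (by norm_num) (by norm_num) (Or.inr (Or.inr (Or.inl rfl)))
  -- The list of maps is empty: this graph has no proper 3-coloring at all.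
  obtain ⟨x, hx, -⟩ := exists_invariant_of_forallExtensions (by norm_num) []
    (by decide +kernel) C h1 h5
  simp at hx

theorem not_distinguishinglyColorable_three_fifteen :
    ¬ (circulantOneK 15 4).DistinguishinglyColorable 3 := by
  rintro ⟨C, hC⟩
  have h1 := C.circulantOneK_add_ne (by norm_num) (by norm_num) (Or.inl rfl)
  have h4 := C.circulantOneK_add_ne (by norm_num) (by norm_num) (Or.inr (Or.inr (Or.inl rfl)))
  -- Here `11 = -4 = -k`; each proper 3-coloring is invariant under some `v ↦ c - 4v` with `c ∈ {0,
  -- 5, 10}` or a translation by 3 or 5.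
  obtain ⟨x, hx, hinv⟩ := exists_invariant_of_forallExtensions (by norm_num)
    [(11, 0), (11, 10), (11, 5), (1, 5), (1, 3)] (by decide +kernel) C h1 h4
  have hstep : IsStep ((4 : ℕ) : ZMod 15) x.1 ∧ ¬ ((x.1 : ZMod 15) = 1 ∧ (x.2 : ZMod 15) = 0) := by
    clear hinv; revert x; decide
  exact hstep.2 (hC.eq_zero_of_affine (by norm_num) (by norm_num) (by decide) hstep.1 hinv)

theorem distinguishinglyColorable_four_thirteen :
    (circulantOneK 13 5).DistinguishinglyColorable 4 := by
  refine distinguishinglyColorable_of_forall (by norm_num) (by norm_num) (by norm_num)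
    (fun v : ZMod 13 => ([3, 2, 0, 3, 2, 1, 0, 1, 0, 3, 2, 1, 0] : List (Fin 4)).getD v.val 0) ?_ ?_ ?_
  · decide
  · decide
  · decide +kernel

theorem distinguishinglyColorable_four_fifteen :
    (circulantOneK 15 4).DistinguishinglyColorable 4 := by
  refine distinguishinglyColorable_of_forall (by norm_num) (by norm_num) (by norm_num)
    (fun v : ZMod 15 => ([3, 0, 3, 0, 1, 2, 1, 3, 0, 3, 0, 2, 1, 2, 1] : List (Fin 4)).getD v.val 0) ?_ ?_ ?_
  · decide
  · decide
  · decide +kernel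

end Small

/-! ### Assembly of the cases -/

theorem distinguishinglyColorable_three {n k : ℕ} (hk : 3 < k) (hkn : 2 * k < n)
    (hne : n ≠ 2 * k + 2) (hsq : (k : ZMod n) ^ 2 = 1 ∨ (k : ZMod n) ^ 2 = -1)
    (h13 : ¬ (n = 13 ∧ k = 5)) (h15 : ¬ (n = 15 ∧ k = 4)) :
    (circulantOneK n k).DistinguishinglyColorable 3 := by
  rcases Nat.mod_two_eq_zero_or_one n with h2 | hodd
  · exact distinguishinglyColorable_three_of_even hk hkn hne (Nat.dvd_of_mod_eq_zero h2) hsq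
  rcases hsq with hsq | hsq
  · exact distinguishinglyColorable_three_of_sq_eq_one hk hkn hne hodd hsq h15
  · refine distinguishinglyColorable_three_of_sq_eq_neg_one hk hkn hne hodd hsq ?_
    rintro rfl
    obtain rfl | rfl | rfl : k = 4 ∨ k = 5 ∨ k = 6 := by omega
    · revert hsq; decide
    · exact h13 ⟨rfl, rfl⟩
    · revert hsq; decide

end SimpleGraph

open SimpleGraph in
theorem theorem8p4 (n k : ℕ) (hk : 3 < k) (hkn : 2 * k < n) (hne : n ≠ 2 * k + 2)
    (hsq : (k : ℤ) ^ 2 ≡ 1 [ZMOD (n : ℤ)] ∨ (k : ℤ) ^ 2 ≡ -1 [ZMOD (n : ℤ)]) :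
    (SimpleGraph.circulantOneK n k).distinguishingChromaticNumber =
      if (n = 13 ∧ k = 5) ∨ (n = 15 ∧ k = 4) then 4 else 3 := by
  have hsq' : (k : ZMod n) ^ 2 = 1 ∨ (k : ZMod n) ^ 2 = -1 := by
    simpa only [← ZMod.intCast_eq_intCast_iff, Int.cast_pow, Int.cast_natCast, Int.cast_neg,
      Int.cast_one] using hsq
  split_ifs with h
  · rcases h with ⟨rfl, rfl⟩ | ⟨rfl, rfl⟩
    · exact distinguishingChromaticNumber_eq_succ distinguishinglyColorable_four_thirteen
        not_distinguishinglyColorable_three_thirteen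
    · exact distinguishingChromaticNumber_eq_succ distinguishinglyColorable_four_fifteen
        not_distinguishinglyColorable_three_fifteen
  · rw [not_or] at h
    exact distinguishingChromaticNumber_eq_succ
      (distinguishinglyColorable_three hk hkn hne hsq' h.1 h.2)
      (not_distinguishinglyColorable_two (by omega) hkn hsq')
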